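/- Throughout, partitions have positive parts, and "parts congruent to $\pm r \pmod{60}$" are parts congruent to $r$ or to $-r$ modulo $60$. When a part is said to have two colors, each copy of it may be taken in either of two colors, and two partitions are the same if and only if they contain each part in each color equally often (so the order of the parts is irrelevant); all other parts have a single color. The empty partition is the only partition of $0$. Let $p_7(n)$ denote the number of partitions of $n$ into parts congruent to $\pm 2, \pm 6, \pm 7, \pm 8, \pm 9, \pm 10, \pm 12, \pm 13, \pm 17, \pm 21, \pm 22, \pm 23, \pm 24, \pm 28 \pmod{60}$, where the parts congruent to $\pm 10 \pmod{60}$ have two colors. Let $p_8(n)$ denote the number of partitions of $n$ into parts congruent to $\pm 1, \pm 3, \pm 4, \pm 10, \pm 11, \pm 12, \pm 14, \pm 16, \pm 18, \pm 19, \pm 24, \pm 26, \pm 27, \pm 29 \pmod{60}$, where the parts congruent to $\pm 10 \pmod{60}$ have two colors. Let $p_9(n)$ denote the number of partitions of $n$ into parts congruent to $\pm 1, \pm 4, \pm 5, \pm 6, \pm 11, \pm 12, \pm 14, \pm 16, \pm 18, \pm 19, \pm 25, \pm 26, \pm 29 \pmod{60}$, where the parts congruent to $\pm 12, \pm 18 \pmod{60}$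 have two colors. Let $p_{10}(n)$ denote the number of partitions of $n$ into parts congruent to $\pm 2, \pm 5, \pm 6, \pm 7, \pm 8, \pm 13, \pm 17, \pm 18, \pm 22, \pm 23, \pm 24, \pm 25, \pm 28 \pmod{60}$, where the parts congruent to $\pm 6, \pm 24 \pmod{60}$ have two colors. Then, for each integer $n > 1$, $$p_7(n) + p_8(n-1) = p_9(n) + p_{10}(n-2).$$ -/

import Mathlib

/-- `k` is congruent to `r` or to `-r` modulo `M` for some `r` in `S`. -/
def CongrPM (M : ℕ) (S : Finset ℕ) (k : ℕ) : Prop :=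
  ∃ r ∈ S, (k : ℤ) ≡ (r : ℤ) [ZMOD (M : ℤ)] ∨ (k : ℤ) ≡ -(r : ℤ) [ZMOD (M : ℤ)]

/-- The colored partitions of `n` into (positive) parts congruent to `± r` modulo `M` with `r ∈ S`,
where the parts congruent to `± r` modulo `M` with `r ∈ D` come in two colors, and all other parts
in one. A colored part is a pair `(k, c)` of its size `k` and its color `c ∈ {0, 1}`; the color `1`
is only available to the two-colored parts. A colored partition is a finite multiset of colored
parts, and it is a partition of the sum of the sizes of its parts. -/
def coloredPartitions (M : ℕ) (S D : Finset ℕ) (n : ℕ) : Set (Multiset (ℕ × Fin 2)) :=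
  {P | (∀ x ∈ P, 0 < x.1 ∧ CongrPM M S x.1 ∧ (x.2 = 1 → CongrPM M D x.1)) ∧
    (P.map Prod.fst).sum = n}

/-- There are only finitely many such colored partitions, so that counting them by `Set.ncard`
is meaningful. -/
theorem coloredPartitions_finite (M : ℕ) (S D : Finset ℕ) (n : ℕ) :
    (coloredPartitions M S D n).Finite := by
  classical
  refine Set.Finite.subset (Multiset.powerset
    (n • (Finset.range (n + 1) ×ˢ (Finset.univ : Finset (Fin 2))).val)).toFinset.finite_toSet ?_
  rintro P ⟨hP, hs⟩
  have hcard : P.card ≤ n := by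
    have h := Multiset.card_nsmul_le_sum (s := P.map Prod.fst) (a := 1) (by
      intro y hy
      obtain ⟨x, hx, rfl⟩ := Multiset.mem_map.1 hy
      exact (hP x hx).1)
    simpa [hs] using h
  simp only [Finset.mem_coe, Multiset.mem_toFinset, Multiset.mem_powerset]
  rw [Multiset.le_iff_count]
  intro x
  by_cases hx : x ∈ P
  · have hle : x.1 ≤ n := by
      rw [← hs]
      exact Multiset.single_le_sum (fun _ _ => Nat.zero_le _) _ (Multiset.mem_map_of_mem _ hx)
    have hmem : x ∈ (Finset.range (n + 1) ×ˢ (Finset.univ : Finset (Fin 2))) := by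
      simp; omega
    rw [Multiset.count_nsmul, Multiset.count_eq_one_of_mem (Finset.nodup _) hmem, mul_one]
    exact (Multiset.count_le_card x P).trans hcard
  · rw [Multiset.count_eq_zero_of_notMem hx]
    exact Nat.zero_le _

/-- The number of colored partitions of `n` of the kind just described. -/
noncomputable def numColoredPartitions (M : ℕ) (S D : Finset ℕ) (n : ℕ) : ℕ :=
  (coloredPartitions M S D n).ncard

/-- The number `p₇(n)`. -/
noncomputable def p7 (n : ℕ) : ℕ :=
  numColoredPartitions 60 {2, 6, 7, 8, 9, 10, 12, 13, 17, 21, 22, 23, 24, 28} {10} n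

/-- The number `p₈(n)`. -/
noncomputable def p8 (n : ℕ) : ℕ :=
  numColoredPartitions 60 {1, 3, 4, 10, 11, 12, 14, 16, 18, 19, 24, 26, 27, 29} {10} n

/-- The number `p₉(n)`. -/
noncomputable def p9 (n : ℕ) : ℕ :=
  numColoredPartitions 60 {1, 4, 5, 6, 11, 12, 14, 16, 18, 19, 25, 26, 29} {12, 18} n

/-- The number `p₁₀(n)`. -/
noncomputable def p10 (n : ℕ) : ℕ :=
  numColoredPartitions 60 {2, 5, 6, 7, 8, 13, 17, 18, 22, 23, 24, 25, 28} {6, 24} n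

/-! For real `0 < q < 1`, the generating function of each family of partitions is the reciprocal of
a product of functions `theta60 q r` (`hasSum_numColoredPartitions`). The claim therefore reduces to
one identity between four such reciprocals, `theta60Prod_identity`, and a comparison of
coefficients, `eq_zero_of_hasSum_pow`.

The identity comes from multiplying two theta series and splitting the double sum by parity
(`thetaSum_mul_thetaSum`); the Jacobi triple product turns this into a statement about products.
Write `t r` for `thetaProd (q ^ 30) (q ^ r)`, and put `p = q ^ 15`. The pairs `(u, v) = (q ^ 4, q)`
and `(q ^ 7, q ^ 2)` give, with one common factor `c`, `A = c (t 5 * t 12 - q * t 10 * t 3)` and `B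
= c (t 9 * t 10 - q ^ 2 * t 6 * t 5)`, where `A` and `B` are the products of the two thetas modulo
15. Eliminating `c` gives `(A * t 9 + q * B * t 3) * t 10 = (B * t 12 + q ^ 2 * A * t 6) * t 5`.
Rewriting everything modulo 60 and dividing by a common product gives the four reciprocals. -/

open Filter Topology

/-! ### Infinite q-products and theta products -/

/-- The infinite product `∏ (1 + z p ^ k)` over `k ≥ 0`. -/
noncomputable def qProd (p z : ℝ) : ℝ := ∏' k : ℕ, (1 + z * p ^ k)

/-- The product side of the Jacobi triple product, without the factor `(p; p)`. -/
noncomputable def thetaProd (p z : ℝ) : ℝ := qProd p z * qProd p (p / z)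

theorem summable_mul_pow {p : ℝ} (h0 : 0 < p) (h1 : p < 1) (z : ℝ) :
    Summable fun k : ℕ => z * p ^ k :=
  (summable_geometric_of_lt_one h0.le h1).mul_left z

theorem multipliable_qProd {p : ℝ} (h0 : 0 < p) (h1 : p < 1) (z : ℝ) :
    Multipliable fun k : ℕ => 1 + z * p ^ k :=
  Real.multipliable_one_add_of_summable (summable_mul_pow h0 h1 z)

theorem tendsto_qProd {p : ℝ} (h0 : 0 < p) (h1 : p < 1) (z : ℝ) :
    Tendsto (fun n => ∏ k ∈ Finset.range n, (1 + z * p ^ k)) atTop (𝓝 (qProd p z)) :=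
  (multipliable_qProd h0 h1 z).tendsto_prod_tprod_nat

theorem qProd_pos {p z : ℝ} (h0 : 0 < p) (h1 : p < 1) (hz : -1 < z) : 0 < qProd p z := by
  have hpos : ∀ k : ℕ, 0 < 1 + z * p ^ k := fun k => by
    have hk : p ^ k ≤ 1 := pow_le_one₀ h0.le h1.le
    have hk0 : 0 < p ^ k := pow_pos h0 k
    nlinarith
  -- A limit of positive partial products is only nonnegative; summability of the `z * p ^ k`
  -- excludes the value 0.
  refine lt_of_le_of_ne ?_ ?_
  · exact ge_of_tendsto' (tendsto_qProd h0 h1 z) fun n => Finset.prod_nonneg fun k _ => (hpos k).le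
  · refine (tprod_one_add_ne_zero_of_summable (f := fun k : ℕ => z * p ^ k)
      (fun k => (hpos k).ne') ?_).symm
    simpa using (summable_mul_pow h0 h1 z).norm

theorem qProd_split {p : ℝ} (h0 : 0 < p) (h1 : p < 1) (z : ℝ) :
    qProd p z = qProd (p ^ 2) z * qProd (p ^ 2) (p * z) := by
  have h2 : p ^ 2 < 1 := pow_lt_one₀ h0.le h1 two_ne_zero
  have he : ∀ k : ℕ, 1 + z * p ^ (2 * k) = 1 + z * (p ^ 2) ^ k := fun k => by rw [pow_mul]
  have ho : ∀ k : ℕ, 1 + z * p ^ (2 * k + 1) = 1 + p * z * (p ^ 2) ^ k := fun k => by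
    rw [pow_succ, pow_mul]; ring
  unfold qProd
  rw [← tprod_even_mul_odd (f := fun k : ℕ => 1 + z * p ^ k)]
  · simp only [he, ho]
  · simp only [he]; exact multipliable_qProd (by positivity) h2 z
  · simp only [ho]; exact multipliable_qProd (by positivity) h2 (p * z)

theorem qProd_mul_neg {p : ℝ} (h0 : 0 < p) (h1 : p < 1) (z : ℝ) :
    qProd p z * qProd p (-z) = qProd (p ^ 2) (-z ^ 2) := by
  unfold qProd
  rw [← (multipliable_qProd h0 h1 z).tprod_mul (multipliable_qProd h0 h1 (-z))]
  congr 1; ext k; ring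

theorem thetaProd_split {p z : ℝ} (h0 : 0 < p) (h1 : p < 1) (hz : z ≠ 0) :
    thetaProd p z = thetaProd (p ^ 2) z * thetaProd (p ^ 2) (p * z) := by
  unfold thetaProd
  rw [qProd_split h0 h1 z, qProd_split h0 h1 (p / z)]
  have e1 : p ^ 2 / (p * z) = p / z := by field_simp
  have e2 : p * (p / z) = p ^ 2 / z := by ring
  rw [e1, e2]; ring

theorem thetaProd_mul_neg {p : ℝ} (h0 : 0 < p) (h1 : p < 1) (z : ℝ) :
    thetaProd p z * thetaProd p (-z) = thetaProd (p ^ 2) (-z ^ 2) := by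
  unfold thetaProd
  have e : p ^ 2 / -z ^ 2 = -(p / z) ^ 2 := by rw [div_neg, div_pow]
  rw [e, ← qProd_mul_neg h0 h1, ← qProd_mul_neg h0 h1, div_neg]; ring

theorem thetaProd_div {p : ℝ} (h0 : p ≠ 0) (z : ℝ) :
    thetaProd p (p / z) = thetaProd p z := by
  unfold thetaProd
  rw [div_div_cancel₀ h0, mul_comm]

/-! ### Gaussian binomials and the q-binomial theorem -/

/-- The finite product `(p; p)_n`. -/
noncomputable def qFact (p : ℝ) (n : ℕ) : ℝ := ∏ k ∈ Finset.range n, (1 - p ^ (k + 1))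

theorem qFact_succ (p : ℝ) (n : ℕ) : qFact p (n + 1) = qFact p n * (1 - p ^ (n + 1)) :=
  Finset.prod_range_succ _ _

theorem one_sub_pow_pos {p : ℝ} (h0 : 0 < p) (h1 : p < 1) (k : ℕ) : 0 < 1 - p ^ (k + 1) :=
  sub_pos.2 (pow_lt_one₀ h0.le h1 k.succ_ne_zero)

theorem qFact_pos {p : ℝ} (h0 : 0 < p) (h1 : p < 1) (n : ℕ) : 0 < qFact p n :=
  Finset.prod_pos fun k _ => one_sub_pow_pos h0 h1 k

theorem tendsto_qFact {p : ℝ} (h0 : 0 < p) (h1 : p < 1) :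
    Tendsto (qFact p) atTop (𝓝 (qProd p (-p))) := by
  refine (tendsto_qProd h0 h1 (-p)).congr fun n => Finset.prod_congr rfl fun k _ => ?_
  ring

theorem antitone_qFact {p : ℝ} (h0 : 0 < p) (h1 : p < 1) : Antitone (qFact p) :=
  antitone_nat_of_succ_le fun n => by
    rw [qFact_succ]
    have := qFact_pos h0 h1 n
    have : 0 < p ^ (n + 1) := pow_pos h0 _
    nlinarith

theorem qProd_le_qFact {p : ℝ} (h0 : 0 < p) (h1 : p < 1) (n : ℕ) : qProd p (-p) ≤ qFact p n :=
  (antitone_qFact h0 h1).le_of_tendsto (tendsto_qFact h0 h1) n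

/-- The Gaussian binomial coefficients. -/
noncomputable def qBinom (p : ℝ) (n i : ℕ) : ℝ :=
  if i ≤ n then qFact p n / (qFact p i * qFact p (n - i)) else 0

theorem qBinom_zero {p : ℝ} (h0 : 0 < p) (h1 : p < 1) (n : ℕ) : qBinom p n 0 = 1 := by
  have := (qFact_pos h0 h1 n).ne'
  rw [qBinom, if_pos n.zero_le, Nat.sub_zero]
  simp [qFact] at this ⊢
  exact this

theorem qBinom_succ {p : ℝ} (h0 : 0 < p) (h1 : p < 1) {n i : ℕ} (hi : i ≤ n) :
    qBinom p (n + 1) (i + 1) = qBinom p n (i + 1) + p ^ (n - i) * qBinom p n i := by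
  obtain ⟨m, rfl⟩ := Nat.exists_eq_add_of_le hi
  have a := (qFact_pos h0 h1 i).ne'
  have a' := (one_sub_pow_pos h0 h1 i).ne'
  have b := (qFact_pos h0 h1 m).ne'
  -- For `m = 0`, that is `i = n`, the coefficient `qBinom p n (i + 1)` is the default value 0.
  rcases m with _ | m
  · have c := (qFact_pos h0 h1 (i + 1)).ne'
    simp [qBinom, qFact] at *
    rw [div_self a, div_self c]
  · have b' := (one_sub_pow_pos h0 h1 m).ne'
    have b'' := (qFact_pos h0 h1 m).ne'
    have e1 : i + (m + 1) + 1 - (i + 1) = m + 1 := by omega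
    have e2 : i + (m + 1) - (i + 1) = m := by omega
    have e3 : i + (m + 1) - i = m + 1 := by omega
    rw [qBinom, qBinom, qBinom, if_pos (by omega), if_pos (by omega), if_pos (by omega), e1, e2, e3,
      qFact_succ p (i + (m + 1)), qFact_succ p i, qFact_succ p m]
    field_simp
    ring

theorem prod_one_add_mul_pow {p : ℝ} (h0 : 0 < p) (h1 : p < 1) (x : ℝ) (n : ℕ) :
    ∏ k ∈ Finset.range n, (1 + x * p ^ k) =
      ∑ i ∈ Finset.range (n + 1), qBinom p n i * p ^ (i.choose 2) * x ^ i := by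
  induction n with
  | zero => simp [qBinom_zero h0 h1]
  | succ n ih =>
    rw [Finset.prod_range_succ, ih, mul_add, mul_one,
      Finset.sum_range_succ' (fun i => qBinom p (n + 1) i * p ^ (i.choose 2) * x ^ i)]
    have hs : ∑ i ∈ Finset.range (n + 1), qBinom p (n + 1) (i + 1) * p ^ ((i + 1).choose 2)
          * x ^ (i + 1) =
        ∑ i ∈ Finset.range (n + 1), qBinom p n (i + 1) * p ^ ((i + 1).choose 2) * x ^ (i + 1) +
        ∑ i ∈ Finset.range (n + 1), qBinom p n i * p ^ (i.choose 2) * x ^ i * (x * p ^ n) := by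
      rw [← Finset.sum_add_distrib]
      refine Finset.sum_congr rfl fun i hi => ?_
      have hi' : i ≤ n := Nat.lt_succ_iff.1 (Finset.mem_range.1 hi)
      rw [qBinom_succ h0 h1 hi', Nat.choose_succ_succ' i 1, Nat.choose_one_right]
      have e : p ^ n = p ^ (n - i) * p ^ i := by rw [← pow_add]; congr 1; omega
      rw [e]; ring
    rw [hs, Finset.sum_mul, Finset.sum_range_succ (fun i => qBinom p n (i + 1) * _ * _) n,
      Finset.sum_range_succ' (fun i => qBinom p n i * _ * _) n, qBinom_zero h0 h1,
      qBinom_zero h0 h1]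
    have hz : qBinom p n (n + 1) = 0 := by simp [qBinom]
    rw [hz]
    ring

/-! ### The Jacobi triple product -/

/-- The terms of the Jacobi triple product series. -/
noncomputable def thetaTerm (p z : ℝ) (j : ℤ) : ℝ := p ^ (j * (j - 1) / 2) * z ^ j

/-- The series side of the Jacobi triple product. -/
noncomputable def thetaSum (p z : ℝ) : ℝ := ∑' j : ℤ, thetaTerm p z j

theorem two_mul_triangle (j : ℤ) : 2 * (j * (j - 1) / 2) = j * (j - 1) :=
  Int.two_mul_ediv_two_of_even (Int.even_mul_pred_self j)

theorem triangle_add_one (j : ℤ) : (j + 1) * (j + 1 - 1) / 2 = j * (j - 1) / 2 + j := by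
  have h1 := two_mul_triangle j
  have h2 := two_mul_triangle (j + 1)
  linarith

theorem thetaTerm_add_one {p z : ℝ} (h0 : 0 < p) (hz : z ≠ 0) (j : ℤ) :
    thetaTerm p z (j + 1) = thetaTerm p z j * (z * p ^ j) := by
  rw [thetaTerm, thetaTerm, triangle_add_one, zpow_add₀ h0.ne', zpow_add_one₀ hz]
  ring

theorem thetaTerm_zero (p z : ℝ) : thetaTerm p z 0 = 1 := by simp [thetaTerm]

theorem thetaTerm_ne_zero {p z : ℝ} (h0 : 0 < p) (hz : z ≠ 0) (j : ℤ) : thetaTerm p z j ≠ 0 :=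
  mul_ne_zero (zpow_ne_zero _ h0.ne') (zpow_ne_zero _ hz)

/-- Ratio test in both directions: consecutive ratios are `z * p ^ j` going up and its inverse going
down, and both tend to 0. -/
theorem summable_thetaTerm {p z : ℝ} (h0 : 0 < p) (h1 : p < 1) (hz : z ≠ 0) :
    Summable (thetaTerm p z) := by
  refine Summable.of_nat_of_neg_add_one ?_ ?_
  · refine summable_of_ratio_test_tendsto_lt_one zero_lt_one
      (Eventually.of_forall fun n => thetaTerm_ne_zero h0 hz _) ?_
    have h : ∀ n : ℕ, ‖thetaTerm p z ((n + 1 : ℕ) : ℤ)‖ / ‖thetaTerm p z (n : ℤ)‖ = |z| * p ^ n := by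
      intro n
      have hn := norm_ne_zero_iff.2 (thetaTerm_ne_zero h0 hz (n : ℤ))
      rw [Nat.cast_succ, thetaTerm_add_one h0 hz, norm_mul, mul_div_cancel_left₀ _ hn]
      simp [abs_of_pos h0]
    simp_rw [h]
    simpa using (tendsto_pow_atTop_nhds_zero_of_lt_one h0.le h1).const_mul |z|
  · refine summable_of_ratio_test_tendsto_lt_one zero_lt_one
      (Eventually.of_forall fun n => thetaTerm_ne_zero h0 hz _) ?_
    have h : ∀ n : ℕ, ‖thetaTerm p z (-(((n + 1 : ℕ) : ℤ) + 1))‖ / ‖thetaTerm p z (-((n : ℤ) + 1))‖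
        = |z|⁻¹ * p ^ (n + 2) := by
      intro n
      have hn := norm_ne_zero_iff.2 (thetaTerm_ne_zero h0 hz (-(((n + 1 : ℕ) : ℤ) + 1)))
      have e : -((n : ℤ) + 1) = -(((n + 1 : ℕ) : ℤ) + 1) + 1 := by push_cast; ring
      have e' : -(((n + 1 : ℕ) : ℤ) + 1) = -((n + 2 : ℕ) : ℤ) := by push_cast; ring
      rw [e, thetaTerm_add_one h0 hz, norm_mul, div_mul_eq_div_div, div_self hn, e', zpow_neg,
        zpow_natCast]
      simp [abs_of_pos h0, mul_comm]
    simp_rw [h]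
    simpa using ((tendsto_pow_atTop_nhds_zero_of_lt_one h0.le h1).comp
      (tendsto_add_atTop_nat 2)).const_mul |z|⁻¹

theorem prod_pow_div {p z : ℝ} (h0 : 0 < p) (hz : z ≠ 0) (n : ℕ) :
    ∏ k ∈ Finset.range n, (p ^ (k + 1) / z) = thetaTerm p z (-n) := by
  induction n with
  | zero => simp [thetaTerm_zero]
  | succ n ih =>
    have e : -(n : ℤ) = -((n + 1 : ℕ) : ℤ) + 1 := by push_cast; ring
    rw [Finset.prod_range_succ, ih, e, thetaTerm_add_one h0 hz, zpow_neg, zpow_natCast]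
    field_simp

theorem thetaTerm_natCast_sub {p z : ℝ} (h0 : 0 < p) (hz : z ≠ 0) (n i : ℕ) :
    thetaTerm p z (-n) * (p ^ (i.choose 2) * (z * p ^ (-n : ℤ)) ^ i) =
      thetaTerm p z ((i : ℤ) - n) := by
  induction i with
  | zero => simp
  | succ i ih =>
    have e : ((i + 1 : ℕ) : ℤ) - n = ((i : ℤ) - n) + 1 := by push_cast; ring
    rw [e, thetaTerm_add_one h0 hz, ← ih, Nat.choose_succ_succ' i 1, Nat.choose_one_right,
      sub_eq_add_neg, zpow_add₀ h0.ne', zpow_natCast]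
    ring

/-- The q-binomial theorem with `2n` factors at `x = z * p ^ (-n)`. The last `n` factors are the `1
+ z * p ^ k`; the first `n`, reversed and multiplied by the `p ^ (k + 1) / z`, are the `1 + p / z *
p ^ k`. -/
theorem finite_jacobi_triple_product {p z : ℝ} (h0 : 0 < p) (h1 : p < 1) (hz : z ≠ 0) (n : ℕ) :
    (∏ k ∈ Finset.range n, (1 + z * p ^ k)) * ∏ k ∈ Finset.range n, (1 + p / z * p ^ k) =
      ∑ i ∈ Finset.range (n + n + 1), qBinom p (n + n) i * thetaTerm p z ((i : ℤ) - n) := by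
  have h := prod_one_add_mul_pow h0 h1 (z * p ^ (-n : ℤ)) (n + n)
  have hp : p ^ (-n : ℤ) = (p ^ n)⁻¹ := by rw [zpow_neg, zpow_natCast]
  have hpn : p ^ n ≠ 0 := (pow_pos h0 n).ne'
  have h2 : ∀ k, 1 + z * p ^ (-n : ℤ) * p ^ (n + k) = 1 + z * p ^ k := fun k => by
    rw [hp, pow_add]; field_simp
  have h3 : ∏ k ∈ Finset.range n, (1 + p / z * p ^ k) =
      (∏ k ∈ Finset.range n, (p ^ (k + 1) / z)) *
        ∏ k ∈ Finset.range n, (1 + z * p ^ (-n : ℤ) * p ^ k) := by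
    rw [← Finset.prod_range_reflect (fun k => 1 + z * p ^ (-n : ℤ) * p ^ k),
      ← Finset.prod_mul_distrib]
    refine Finset.prod_congr rfl fun k hk => ?_
    have e : p ^ n = p ^ (n - 1 - k) * p ^ (k + 1) := by
      rw [← pow_add]; congr 1; have := Finset.mem_range.1 hk; omega
    have ha : p ^ (n - 1 - k) ≠ 0 := (pow_pos h0 _).ne'
    rw [hp, e]; field_simp; ring
  rw [Finset.prod_range_add] at h
  simp_rw [h2] at h
  rw [h3, prod_pow_div h0 hz, mul_left_comm, mul_comm (∏ k ∈ Finset.range n, (1 + z * p ^ k)), h,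
    Finset.mul_sum]
  refine Finset.sum_congr rfl fun i _ => ?_
  rw [← thetaTerm_natCast_sub h0 hz]; ring

theorem qBinom_nonneg {p : ℝ} (h0 : 0 < p) (h1 : p < 1) (n i : ℕ) : 0 ≤ qBinom p n i := by
  have := qFact_pos h0 h1
  unfold qBinom
  split_ifs
  · exact div_nonneg (this _).le (mul_pos (this _) (this _)).le
  · exact le_rfl

/-- A bound independent of `n` and `i`, which supplies the dominating series for the limit in
`jacobi_triple_product`. -/
theorem qBinom_le {p : ℝ} (h0 : 0 < p) (h1 : p < 1) (n i : ℕ) :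
    qBinom p n i ≤ 1 / (qProd p (-p) * qProd p (-p)) := by
  have hP : 0 < qProd p (-p) := qProd_pos h0 h1 (by linarith)
  unfold qBinom
  split_ifs
  · refine div_le_div₀ zero_le_one ?_ (mul_pos hP hP) ?_
    · simpa [qFact] using antitone_qFact h0 h1 n.zero_le
    · exact mul_le_mul (qProd_le_qFact h0 h1 _) (qProd_le_qFact h0 h1 _) hP.le
        (qFact_pos h0 h1 _).le
  · positivity

theorem tendsto_qBinom {p : ℝ} (h0 : 0 < p) (h1 : p < 1) (j : ℤ) :
    Tendsto (fun n : ℕ => qBinom p (n + n) (j + n).toNat) atTop (𝓝 (1 / qProd p (-p))) := by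
  have hP : 0 < qProd p (-p) := qProd_pos h0 h1 (by linarith)
  have hQ := tendsto_qFact h0 h1
  have t1 : Tendsto (fun n : ℕ => n + n) atTop atTop :=
    tendsto_atTop_mono (fun n => Nat.le_add_left n n) tendsto_id
  have t2 : Tendsto (fun n : ℕ => (j + n).toNat) atTop atTop :=
    tendsto_atTop.2 fun b => (eventually_ge_atTop (b + j.natAbs)).mono fun n hn => by omega
  have t3 : Tendsto (fun n : ℕ => n + n - (j + n).toNat) atTop atTop :=
    tendsto_atTop.2 fun b => (eventually_ge_atTop (b + j.natAbs)).mono fun n hn => by omega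
  have h := (hQ.comp t1).div ((hQ.comp t2).mul (hQ.comp t3)) (mul_pos hP hP).ne'
  have e : qProd p (-p) / (qProd p (-p) * qProd p (-p)) = 1 / qProd p (-p) := by field_simp
  rw [e] at h
  refine h.congr' ((eventually_ge_atTop j.natAbs).mono fun n hn => ?_)
  simp only [Pi.div_apply, Function.comp_apply, qBinom]
  rw [if_pos (by omega)]

theorem jacobi_triple_product {p z : ℝ} (h0 : 0 < p) (h1 : p < 1) (hz : z ≠ 0) :
    thetaSum p z = qProd p (-p) * thetaProd p z := by
  have hP : 0 < qProd p (-p) := qProd_pos h0 h1 (by linarith)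
  -- The finite identity reindexed by `j = i - n` and extended by zero. The guard is needed because
  -- `toNat` sends `j < -n` to 0, where `qBinom` is 1; for `j > n` the coefficient already vanishes.
  let F : ℕ → ℤ → ℝ := fun n j =>
    if -(n : ℤ) ≤ j then qBinom p (n + n) (j + n).toNat * thetaTerm p z j else 0
  have hF : ∀ n, ∑' j, F n j =
      (∏ k ∈ Finset.range n, (1 + z * p ^ k)) * ∏ k ∈ Finset.range n, (1 + p / z * p ^ k) := by
    intro n
    rw [finite_jacobi_triple_product h0 h1 hz]
    have hinj : Function.Injective fun i : ℕ => (i : ℤ) - n := fun a b h => by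
      simpa using h
    rw [tsum_eq_sum (s := (Finset.range (n + n + 1)).map ⟨_, hinj⟩), Finset.sum_map]
    · refine Finset.sum_congr rfl fun i _ => ?_
      simp [F]
    · intro j hj
      simp only [F]
      split_ifs with h
      · have hlt : n + n < (j + n).toNat := by
          by_contra hc
          refine hj (Finset.mem_map.2 ⟨(j + n).toNat, Finset.mem_range.2 (by omega), ?_⟩)
          simp only [Function.Embedding.coeFn_mk]; omega
        rw [qBinom, if_neg (by omega), zero_mul]
      · rfl
  have hlim : Tendsto (fun n => ∑' j, F n j) atTop
      (𝓝 (∑' j, 1 / qProd p (-p) * thetaTerm p z j)) := by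
    refine tendsto_tsum_of_dominated_convergence
      ((summable_thetaTerm h0 h1 hz).norm.mul_left (1 / (qProd p (-p) * qProd p (-p)))) ?_ ?_
    · intro j
      refine ((tendsto_qBinom h0 h1 j).mul_const (thetaTerm p z j)).congr'
        ((eventually_ge_atTop j.natAbs).mono fun n hn => ?_)
      simp only [F]
      rw [if_pos (by omega)]
    · refine Eventually.of_forall fun n j => ?_
      simp only [F]
      split_ifs
      · rw [norm_mul, Real.norm_of_nonneg (qBinom_nonneg h0 h1 _ _)]
        exact mul_le_mul_of_nonneg_right (qBinom_le h0 h1 _ _) (norm_nonneg _)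
      · rw [norm_zero]; positivity
  simp_rw [hF] at hlim
  have h := tendsto_nhds_unique hlim ((tendsto_qProd h0 h1 z).mul (tendsto_qProd h0 h1 (p / z)))
  rw [tsum_mul_left] at h
  rw [thetaProd, ← h, thetaSum]
  field_simp

/-! ### The product of two theta series -/

/-- Sums over pairs of integers, split according to whether the two entries have equal parity. -/
theorem hasSum_int_prod_parity {f : ℤ × ℤ → ℝ} {a b : ℝ}
    (ha : HasSum (fun x : ℤ × ℤ => f (x.1 + x.2, x.1 - x.2)) a)
    (hb : HasSum (fun x : ℤ × ℤ => f (x.1 + x.2, x.1 - x.2 + 1)) b) : HasSum f (a + b) := by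
  have i1 : Function.Injective fun x : ℤ × ℤ => (x.1 + x.2, x.1 - x.2) := by
    rintro ⟨a, b⟩ ⟨c, d⟩ h; simp only [Prod.mk.injEq] at h ⊢; omega
  have i2 : Function.Injective fun x : ℤ × ℤ => (x.1 + x.2, x.1 - x.2 + 1) := by
    rintro ⟨a, b⟩ ⟨c, d⟩ h; simp only [Prod.mk.injEq] at h ⊢; omega
  refine HasSum.add_isCompl ⟨?_, ?_⟩ (i1.hasSum_range_iff.2 ha) (i2.hasSum_range_iff.2 hb)
  · rw [Set.disjoint_left]
    rintro _ ⟨⟨a, b⟩, rfl⟩ ⟨⟨c, d⟩, h⟩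
    simp only [Prod.mk.injEq] at h; omega
  · refine codisjoint_iff.2 (Set.eq_univ_iff_forall.2 ?_)
    rintro ⟨m, n⟩
    rcases Int.even_or_odd' (m + n) with ⟨k, hk | hk⟩
    · exact Or.inl ⟨(k, m - k), by simp only [Prod.mk.injEq]; omega⟩
    · exact Or.inr ⟨(k, m - k), by simp only [Prod.mk.injEq]; omega⟩

theorem thetaTerm_neg_mul_thetaTerm_neg {p u v : ℝ} (h0 : 0 < p) (m n : ℤ) :
    thetaTerm p (-u) m * thetaTerm p (-v) n =
      (-1) ^ (m + n) * p ^ ((m * (m - 1) + n * (n - 1)) / 2) * (u ^ m * v ^ n) := by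
  have e : (m * (m - 1) + n * (n - 1)) / 2 = m * (m - 1) / 2 + n * (n - 1) / 2 := by
    have h1 := two_mul_triangle m
    have h2 := two_mul_triangle n
    omega
  rw [thetaTerm, thetaTerm, e, zpow_add₀ h0.ne', zpow_add₀ (by norm_num : (-1 : ℝ) ≠ 0),
    neg_eq_neg_one_mul u, neg_eq_neg_one_mul v, mul_zpow, mul_zpow]
  ring

theorem thetaTerm_sq (p z : ℝ) (j : ℤ) : thetaTerm (p ^ 2) z j = p ^ (j * (j - 1)) * z ^ j := by
  have h := zpow_mul p 2 (j * (j - 1) / 2)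
  rw [two_mul_triangle] at h
  rw [thetaTerm, h]
  norm_cast

/-- In the double sum over `(m, n)`, put `m = i + j` and `n = i - j` or `n = i - j + 1`. In both
cases the quadratic exponent separates in `i` and `j`. The odd case carries the sign and the extra
factor `v`. -/
theorem thetaSum_mul_thetaSum {p u v : ℝ} (h0 : 0 < p) (h1 : p < 1) (hu : u ≠ 0) (hv : v ≠ 0) :
    thetaSum p (-u) * thetaSum p (-v) =
      thetaSum (p ^ 2) (u * v) * thetaSum (p ^ 2) (p * (u / v)) -
        v * (thetaSum (p ^ 2) (p * (u * v)) * thetaSum (p ^ 2) (u / v)) := by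
  have h2 : p ^ 2 < 1 := pow_lt_one₀ h0.le h1 two_ne_zero
  have hp := h0.ne'
  have h02 : 0 < p ^ 2 := by positivity
  have hs : ∀ {r z w : ℝ}, 0 < r → r < 1 → z ≠ 0 → w ≠ 0 →
      HasSum (fun x : ℤ × ℤ => thetaTerm r z x.1 * thetaTerm r w x.2)
        (thetaSum r z * thetaSum r w) := fun r0 r1 hz hw =>
    (summable_thetaTerm r0 r1 hz).hasSum.mul (summable_thetaTerm r0 r1 hw).hasSum
      (summable_mul_of_summable_norm (summable_thetaTerm r0 r1 hz).norm
        (summable_thetaTerm r0 r1 hw).norm)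
  have hodd := (hs h02 h2 (mul_ne_zero hp (mul_ne_zero hu hv)) (div_ne_zero hu hv)).mul_left (-v)
  have heven := hs h02 h2 (mul_ne_zero hu hv) (mul_ne_zero hp (div_ne_zero hu hv))
  have key := hasSum_int_prod_parity
    (f := fun x => thetaTerm p (-u) x.1 * thetaTerm p (-v) x.2) (heven.congr_fun ?_)
    (hodd.congr_fun ?_)
  · rw [(hs h0 h1 (neg_ne_zero.2 hu) (neg_ne_zero.2 hv)).unique key]; ring
  · rintro ⟨i, j⟩
    have e : ((i + j) * (i + j - 1) + (i - j) * (i - j - 1)) / 2 = i * (i - 1) + j * (j - 1) + j :=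
      Int.ediv_eq_of_eq_mul_right two_ne_zero (by ring)
    have e' : i + j + (i - j) = 2 * i := by ring
    dsimp only
    rw [thetaTerm_neg_mul_thetaTerm_neg h0, thetaTerm_sq, thetaTerm_sq, e, e', zpow_add₀ hp,
      zpow_add₀ hp, zpow_add₀ hu, zpow_sub₀ hv, mul_zpow u, mul_zpow p, div_zpow,
      (even_two_mul i).neg_one_zpow]
    ring
  · rintro ⟨i, j⟩
    have e : ((i + j) * (i + j - 1) + (i - j + 1) * (i - j + 1 - 1)) / 2 =
        i * (i - 1) + i + j * (j - 1) := Int.ediv_eq_of_eq_mul_right two_ne_zero (by ring)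
    have e' : i + j + (i - j + 1) = 2 * i + 1 := by ring
    dsimp only
    rw [thetaTerm_neg_mul_thetaTerm_neg h0, thetaTerm_sq, thetaTerm_sq, e, e', zpow_add₀ hp,
      zpow_add₀ hp, zpow_add₀ hu, zpow_add_one₀ hv, zpow_sub₀ hv, mul_zpow p, mul_zpow u, div_zpow,
      (odd_two_mul_add_one i).neg_one_zpow]
    ring

theorem thetaProd_mul_thetaProd {p u v : ℝ} (h0 : 0 < p) (h1 : p < 1) (hu : u ≠ 0) (hv : v ≠ 0) :
    qProd p (-p) ^ 2 * (thetaProd p (-u) * thetaProd p (-v)) =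
      qProd (p ^ 2) (-p ^ 2) ^ 2 *
        (thetaProd (p ^ 2) (u * v) * thetaProd (p ^ 2) (p * (u / v)) -
          v * (thetaProd (p ^ 2) (p * (u * v)) * thetaProd (p ^ 2) (u / v))) := by
  have h := thetaSum_mul_thetaSum h0 h1 hu hv
  have h2 : p ^ 2 < 1 := pow_lt_one₀ h0.le h1 two_ne_zero
  have h02 : 0 < p ^ 2 := by positivity
  have huv := mul_ne_zero hu hv
  have hduv := div_ne_zero hu hv
  rw [jacobi_triple_product h0 h1 (neg_ne_zero.2 hu), jacobi_triple_product h0 h1 (neg_ne_zero.2 hv),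
    jacobi_triple_product h02 h2 huv, jacobi_triple_product h02 h2 hduv,
    jacobi_triple_product h02 h2 (mul_ne_zero h0.ne' huv),
    jacobi_triple_product h02 h2 (mul_ne_zero h0.ne' hduv)] at h
  linear_combination h

/-! ### The theta product identity modulo 60 -/

/-- The product of all `1 - q ^ k` with `k > 0` congruent to `r` or to `-r` modulo `60`. -/
noncomputable def theta60 (q : ℝ) (r : ℕ) : ℝ := thetaProd (q ^ 60) (-q ^ r)

theorem thetaProd_neg_pow_pos {q : ℝ} (h0 : 0 < q) (h1 : q < 1) {m r : ℕ} (hr : 0 < r)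
    (hm : r < m) : 0 < thetaProd (q ^ m) (-q ^ r) := by
  have hm0 : 0 < q ^ m := pow_pos h0 m
  have hm1 : q ^ m < 1 := pow_lt_one₀ h0.le h1 (by omega)
  have e : q ^ m / -q ^ r = -q ^ (m - r) := by
    rw [div_neg, pow_sub₀ q h0.ne' hm.le, div_eq_mul_inv]
  refine mul_pos (qProd_pos hm0 hm1 ?_) (qProd_pos hm0 hm1 ?_)
  · exact neg_lt_neg (pow_lt_one₀ h0.le h1 hr.ne')
  · rw [e]; exact neg_lt_neg (pow_lt_one₀ h0.le h1 (by omega))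

theorem theta60_pos {q : ℝ} (h0 : 0 < q) (h1 : q < 1) {r : ℕ} (hr : 0 < r) (hr' : r < 60) :
    0 < theta60 q r := thetaProd_neg_pow_pos h0 h1 hr hr'

theorem theta60_symm {q : ℝ} (h0 : 0 < q) {r s : ℕ} (h : r + s = 60) :
    theta60 q r = theta60 q s := by
  have e : q ^ 60 / -q ^ s = -q ^ r := by
    rw [← h, pow_add, div_neg]; field_simp
  rw [theta60, theta60, ← e, thetaProd_div (by positivity)]

/-- The classes `± r` modulo 30 are `± r` and `± (30 + r)` modulo 60, and `30 + r` is `-s` modulo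
60. -/
theorem thetaProd_pow_thirty {q : ℝ} (h0 : 0 < q) (h1 : q < 1) {r s : ℕ} (h : r + s = 30) :
    thetaProd (q ^ 30) (-q ^ r) = theta60 q r * theta60 q s := by
  have e : q ^ 30 * -q ^ r = -q ^ (30 + r) := by ring
  rw [thetaProd_split (pow_pos h0 30) (pow_lt_one₀ h0.le h1 (by norm_num)) (by simp [h0.ne']),
    ← pow_mul, e]
  change theta60 q r * theta60 q (30 + r) = _
  rw [theta60_symm h0 (show 30 + r + s = 60 by omega)]

theorem thetaProd_pow_fifteen {q : ℝ} (h0 : 0 < q) (h1 : q < 1) {r s : ℕ} (h : r + s = 15) :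
    thetaProd (q ^ 15) (-q ^ r) =
      theta60 q r * theta60 q s * theta60 q (15 + r) * theta60 q (15 + s) := by
  have e : q ^ 15 * -q ^ r = -q ^ (15 + r) := by ring
  rw [thetaProd_split (pow_pos h0 15) (pow_lt_one₀ h0.le h1 (by norm_num)) (by simp [h0.ne']),
    ← pow_mul, e, thetaProd_pow_thirty h0 h1 (show r + (15 + s) = 30 by omega),
    thetaProd_pow_thirty h0 h1 (show 15 + r + s = 30 by omega)]
  ring

/-- Plus signs are removed by `thetaProd_mul_neg`: the thetas at `q ^ r` and `-q ^ r` multiply to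
the theta at `-q ^ (2 * r)` with base `q ^ 60`. -/
theorem thetaProd_pos_pow_thirty {q : ℝ} (h0 : 0 < q) (h1 : q < 1) {r s : ℕ} (h : r + s = 30)
    (hr : 0 < r) (hs : 0 < s) :
    thetaProd (q ^ 30) (q ^ r) = theta60 q (2 * r) / (theta60 q r * theta60 q s) := by
  have hpos := thetaProd_neg_pow_pos h0 h1 hr (show r < 30 by omega)
  have hm := thetaProd_mul_neg (pow_pos h0 30) (pow_lt_one₀ h0.le h1 (by norm_num)) (q ^ r)
  rw [← thetaProd_pow_thirty h0 h1 h, eq_div_iff hpos.ne', hm, theta60, ← pow_mul, ← pow_mul,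
    mul_comm r 2]

theorem thetaProd_pow_symm {q : ℝ} (h0 : 0 < q) {m r s : ℕ} (h : r + s = m) :
    thetaProd (q ^ m) (q ^ r) = thetaProd (q ^ m) (q ^ s) := by
  have e : q ^ m / q ^ s = q ^ r := by
    rw [← h, pow_add]; field_simp
  rw [← e, thetaProd_div (by positivity)]

theorem thetaProd_level_thirty {q : ℝ} (h0 : 0 < q) (h1 : q < 1) :
    (thetaProd (q ^ 15) (-q ^ 4) * thetaProd (q ^ 15) (-q ^ 1) * thetaProd (q ^ 30) (q ^ 9) +
      q * (thetaProd (q ^ 15) (-q ^ 7) * thetaProd (q ^ 15) (-q ^ 2)) *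
        thetaProd (q ^ 30) (q ^ 3)) * thetaProd (q ^ 30) (q ^ 10) =
    (thetaProd (q ^ 15) (-q ^ 7) * thetaProd (q ^ 15) (-q ^ 2) * thetaProd (q ^ 30) (q ^ 12) +
      q ^ 2 * (thetaProd (q ^ 15) (-q ^ 4) * thetaProd (q ^ 15) (-q ^ 1)) *
        thetaProd (q ^ 30) (q ^ 6)) * thetaProd (q ^ 30) (q ^ 5) := by
  have hq := h0.ne'
  have p0 : 0 < q ^ 15 := pow_pos h0 15
  have p1 : q ^ 15 < 1 := pow_lt_one₀ h0.le h1 (by norm_num)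
  have hP : qProd (q ^ 15) (-q ^ 15) ≠ 0 := (qProd_pos p0 p1 (neg_lt_neg p1)).ne'
  have a := thetaProd_mul_thetaProd p0 p1 (pow_ne_zero 4 hq) (pow_ne_zero 1 hq)
  have b := thetaProd_mul_thetaProd p0 p1 (pow_ne_zero 7 hq) (pow_ne_zero 2 hq)
  have d1 : q ^ 4 / q ^ 1 = q ^ 3 := by field_simp
  have d2 : q ^ 7 / q ^ 2 = q ^ 5 := by field_simp
  rw [d1] at a
  rw [d2] at b
  simp only [← pow_mul, ← pow_add] at a b
  norm_num only at a b
  rw [thetaProd_pow_symm h0 (show 18 + 12 = 30 by rfl),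
    thetaProd_pow_symm h0 (show 20 + 10 = 30 by rfl)] at a
  rw [thetaProd_pow_symm h0 (show 20 + 10 = 30 by rfl),
    thetaProd_pow_symm h0 (show 24 + 6 = 30 by rfl)] at b
  -- Up to the factor cancelled here, `a` and `b` express the two products modulo 15 by thetas
  -- modulo 30; cross-multiplying them eliminates the common factor on their right sides.
  apply mul_left_cancel₀ (pow_ne_zero 2 hP)
  linear_combination
    (thetaProd (q ^ 30) (q ^ 9) * thetaProd (q ^ 30) (q ^ 10) -
      q ^ 2 * thetaProd (q ^ 30) (q ^ 6) * thetaProd (q ^ 30) (q ^ 5)) * a +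
    (q * thetaProd (q ^ 30) (q ^ 3) * thetaProd (q ^ 30) (q ^ 10) -
      thetaProd (q ^ 30) (q ^ 12) * thetaProd (q ^ 30) (q ^ 5)) * b

/-- The product of the `theta60 q r` over `r ∈ S`. -/
noncomputable def theta60Prod (q : ℝ) (S : Finset ℕ) : ℝ := ∏ r ∈ S, theta60 q r

theorem one_div_add_div_eq {K : Type*} [Field K]
    {q A B f3 f5 f6 f9 f10 f12 f18 f20 f21 f24 f25 f27 : K} (hA : A ≠ 0) (hB : B ≠ 0)
    (h3 : f3 ≠ 0) (h5 : f5 ≠ 0) (h6 : f6 ≠ 0) (h9 : f9 ≠ 0) (h10 : f10 ≠ 0) (h12 : f12 ≠ 0)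
    (h18 : f18 ≠ 0) (h20 : f20 ≠ 0) (h21 : f21 ≠ 0) (h24 : f24 ≠ 0) (h25 : f25 ≠ 0) (h27 : f27 ≠ 0)
    (h : (A * (f18 / (f9 * f21)) + q * B * (f6 / (f3 * f27))) * (f20 / (f10 * f20)) =
      (B * (f24 / (f12 * f18)) + q ^ 2 * A * (f12 / (f6 * f24))) * (f10 / (f5 * f25))) :
    1 / (B * (f6 * f9 * f21 * f10 ^ 2 * f12 * f24)) +
        q / (A * (f3 * f27 * f10 ^ 2 * f12 * f18 * f24)) =
      1 / (A * (f5 * f25 * f6 * f12 ^ 2 * f18 ^ 2)) +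
        q ^ 2 / (B * (f5 * f25 * f6 ^ 2 * f24 ^ 2 * f18)) := by
  -- Multiplying the four reciprocals by this product gives the two sides of `h` expanded.
  have hK : A * B * (f6 * f18 * f10 * f12 * f24) ≠ 0 := by positivity
  apply mul_left_cancel₀ hK
  calc _ = (A * (f18 / (f9 * f21)) + q * B * (f6 / (f3 * f27))) * (f20 / (f10 * f20)) := by
        field_simp
    _ = _ := h
    _ = _ := by field_simp

theorem theta60Prod_identity {q : ℝ} (h0 : 0 < q) (h1 : q < 1) :
    1 / (theta60Prod q {2, 6, 7, 8, 9, 10, 12, 13, 17, 21, 22, 23, 24, 28} * theta60Prod q {10}) +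
      q / (theta60Prod q {1, 3, 4, 10, 11, 12, 14, 16, 18, 19, 24, 26, 27, 29} *
        theta60Prod q {10}) =
    1 / (theta60Prod q {1, 4, 5, 6, 11, 12, 14, 16, 18, 19, 25, 26, 29} *
        theta60Prod q {12, 18}) +
      q ^ 2 / (theta60Prod q {2, 5, 6, 7, 8, 13, 17, 18, 22, 23, 24, 25, 28} *
        theta60Prod q {6, 24}) := by
  have hf : ∀ r : ℕ, 0 < r → r < 60 → theta60 q r ≠ 0 := fun r hr hr' =>
    (theta60_pos h0 h1 hr hr').ne'
  have key := thetaProd_level_thirty h0 h1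
  rw [thetaProd_pow_fifteen h0 h1 (show 4 + 11 = 15 by rfl),
    thetaProd_pow_fifteen h0 h1 (show 1 + 14 = 15 by rfl),
    thetaProd_pow_fifteen h0 h1 (show 7 + 8 = 15 by rfl),
    thetaProd_pow_fifteen h0 h1 (show 2 + 13 = 15 by rfl),
    thetaProd_pos_pow_thirty h0 h1 (show 9 + 21 = 30 by rfl) (by norm_num) (by norm_num),
    thetaProd_pos_pow_thirty h0 h1 (show 3 + 27 = 30 by rfl) (by norm_num) (by norm_num),
    thetaProd_pos_pow_thirty h0 h1 (show 10 + 20 = 30 by rfl) (by norm_num) (by norm_num),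
    thetaProd_pos_pow_thirty h0 h1 (show 12 + 18 = 30 by rfl) (by norm_num) (by norm_num),
    thetaProd_pos_pow_thirty h0 h1 (show 6 + 24 = 30 by rfl) (by norm_num) (by norm_num),
    thetaProd_pos_pow_thirty h0 h1 (show 5 + 25 = 30 by rfl) (by norm_num) (by norm_num)] at key
  norm_num only at key
  simp only [theta60Prod]
  repeat rw [Finset.prod_insert (by decide)]
  simp only [Finset.prod_singleton]
  have h := one_div_add_div_eq ?_ ?_ (hf 3 ?_ ?_) (hf 5 ?_ ?_) (hf 6 ?_ ?_) (hf 9 ?_ ?_)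
    (hf 10 ?_ ?_) (hf 12 ?_ ?_) (hf 18 ?_ ?_) (hf 20 ?_ ?_) (hf 21 ?_ ?_) (hf 24 ?_ ?_)
    (hf 25 ?_ ?_) (hf 27 ?_ ?_) key
  · convert h using 3 <;> ring
  all_goals norm_num [hf]

/-! ### Generating functions of weighted multisets -/

/-- The multisets with elements in `s` of total weight `n`. -/
def weightedMultisets {α : Type*} (w : α → ℕ) (s : Finset α) (n : ℕ) : Set (Multiset α) :=
  {P | (∀ x ∈ P, x ∈ s) ∧ (P.map w).sum = n}

theorem weightedMultisets_empty {α : Type*} (w : α → ℕ) (n : ℕ) :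
    weightedMultisets w ∅ n = if n = 0 then {0} else ∅ := by
  ext P
  simp only [weightedMultisets, Finset.notMem_empty, Set.mem_ofPred_eq]
  constructor
  · rintro ⟨h, rfl⟩
    rw [Multiset.eq_zero_of_forall_notMem h]; simp
  · split_ifs with h
    · rintro rfl; simp [h]
    · exact False.elim

/-- Either `a` does not occur, or one copy of it can be removed. The full set recurs on the right,
so the counts satisfy `G = F + q ^ w a * G`, whence the geometric factor. -/
theorem weightedMultisets_insert {α : Type*} [DecidableEq α] (w : α → ℕ) {s : Finset α} {a : α}
    (ha : a ∉ s) (n : ℕ) :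
    weightedMultisets w (insert a s) n = weightedMultisets w s n ∪
      if w a ≤ n then (a ::ₘ ·) '' weightedMultisets w (insert a s) (n - w a) else ∅ := by
  ext P
  constructor
  · rintro ⟨h, hn⟩
    by_cases haP : a ∈ P
    · obtain ⟨Q, rfl⟩ := Multiset.exists_cons_of_mem haP
      rw [Multiset.map_cons, Multiset.sum_cons] at hn
      rw [if_pos (by omega)]
      exact Or.inr ⟨Q, ⟨fun x hx => h x (Multiset.mem_cons_of_mem hx), by omega⟩, rfl⟩
    · exact Or.inl ⟨fun x hx => (Finset.mem_insert.1 (h x hx)).resolve_left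
        fun e => haP (e ▸ hx), hn⟩
  · rintro (⟨h, hn⟩ | h)
    · exact ⟨fun x hx => Finset.mem_insert_of_mem (h x hx), hn⟩
    · split_ifs at h with hw
      · obtain ⟨Q, ⟨hQ, hn⟩, rfl⟩ := h
        refine ⟨fun x hx => ?_, ?_⟩
        · rcases Multiset.mem_cons.1 hx with rfl | hx
          · exact Finset.mem_insert_self _ _
          · exact hQ x hx
        · simp only [Multiset.map_cons, Multiset.sum_cons]; omega
      · exact h.elim

theorem weightedMultisets_finite {α : Type*} {w : α → ℕ} {s : Finset α} (hw : ∀ a ∈ s, 0 < w a)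
    (n : ℕ) : (weightedMultisets w s n).Finite := by
  classical
  induction s using Finset.induction_on generalizing n with
  | empty => rw [weightedMultisets_empty]; split_ifs <;> simp
  | insert a s ha ih =>
    induction n using Nat.strong_induction_on with
    | _ n ihn =>
      rw [weightedMultisets_insert w ha]
      refine (ih (fun b hb => hw b (Finset.mem_insert_of_mem hb)) n).union ?_
      have := hw a (Finset.mem_insert_self a s)
      split_ifs with h
      · exact (ihn _ (by omega)).image _
      · exact Set.finite_empty

theorem ncard_weightedMultisets_insert {α : Type*} [DecidableEq α] {w : α → ℕ} {s : Finset α}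
    {a : α} (ha : a ∉ s) (hw : ∀ b ∈ insert a s, 0 < w b) (n : ℕ) :
    (weightedMultisets w (insert a s) n).ncard = (weightedMultisets w s n).ncard +
      if w a ≤ n then (weightedMultisets w (insert a s) (n - w a)).ncard else 0 := by
  have hfin := weightedMultisets_finite hw
  conv_lhs => rw [weightedMultisets_insert w ha]
  rw [Set.ncard_union_eq ?_ ?_ ?_]
  · congr 1
    split_ifs
    · exact Set.ncard_image_of_injective _ fun P Q h => (Multiset.cons_inj_right a).1 h
    · exact Set.ncard_empty _
  · rw [Set.disjoint_left]
    rintro P ⟨h, _⟩ hP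
    split_ifs at hP
    · obtain ⟨Q, _, rfl⟩ := hP
      exact ha (h a (Multiset.mem_cons_self a Q))
    · exact hP
  · exact weightedMultisets_finite (fun b hb => hw b (Finset.mem_insert_of_mem hb)) n
  · split_ifs
    · exact (hfin _).image _
    · exact Set.finite_empty

theorem hasSum_shift {g : ℕ → ℝ} {G : ℝ} (h : HasSum g G) (w : ℕ) :
    HasSum (fun n => if w ≤ n then g (n - w) else 0) G := by
  rw [← (add_left_injective w).hasSum_iff]
  · simpa [Function.comp_def] using h
  · intro n hn
    rw [if_neg]
    exact fun hle => hn ⟨n - w, by simp; omega⟩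

/-- Summing the recursion gives `G = F + c * G`, but convergence must come first: by nonnegativity
the partial sums of `g` are at most `F / (1 - c)`. -/
theorem hasSum_of_shift_recursion {f g : ℕ → ℝ} {F c : ℝ} (hf : HasSum f F) (hf0 : ∀ n, 0 ≤ f n)
    (hg0 : ∀ n, 0 ≤ g n) (hc0 : 0 ≤ c) (hc : c < 1) (w : ℕ)
    (h : ∀ n, g n = f n + c * if w ≤ n then g (n - w) else 0) : HasSum g (F * (1 - c)⁻¹) := by
  have hc' : 0 < 1 - c := sub_pos.2 hc
  have hshift : ∀ N, ∑ n ∈ Finset.range N, (if w ≤ n then g (n - w) else 0) ≤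
      ∑ n ∈ Finset.range N, g n := fun N => by
    rcases le_total w N with hN | hN
    · obtain ⟨m, rfl⟩ := Nat.exists_eq_add_of_le hN
      rw [Finset.sum_range_add, Finset.sum_eq_zero, zero_add]
      · simp only [le_add_iff_nonneg_right, zero_le, if_true, Nat.add_sub_cancel_left]
        exact Finset.sum_le_sum_of_subset_of_nonneg (by simp) fun i _ _ => hg0 i
      · intro n hn
        rw [if_neg (by simpa using hn)]
    · rw [Finset.sum_eq_zero]
      · exact Finset.sum_nonneg fun i _ => hg0 i
      · intro n hn
        rw [if_neg]
        have := Finset.mem_range.1 hn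
        omega
  have hsum : Summable g := by
    refine summable_of_sum_range_le (c := F / (1 - c)) hg0 fun N => ?_
    have h1 : ∑ n ∈ Finset.range N, g n = ∑ n ∈ Finset.range N, f n +
        c * ∑ n ∈ Finset.range N, (if w ≤ n then g (n - w) else 0) := by
      rw [Finset.mul_sum, ← Finset.sum_add_distrib]
      exact Finset.sum_congr rfl fun n _ => h n
    have h2 := sum_le_hasSum (Finset.range N) (fun i _ => hf0 i) hf
    have h3 := mul_le_mul_of_nonneg_left (hshift N) hc0
    rw [le_div_iff₀ hc']
    linarith
  have h4 := hf.add ((hasSum_shift hsum.hasSum w).mul_left c)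
  have h5 := (hsum.hasSum.congr_fun fun n => (h n).symm).unique h4
  have h6 : ∑' n, g n = F * (1 - c)⁻¹ := by
    rw [← div_eq_mul_inv, eq_div_iff hc'.ne']; linarith
  exact h6 ▸ hsum.hasSum

theorem hasSum_ncard_weightedMultisets {α : Type*} {w : α → ℕ} {s : Finset α}
    (hw : ∀ a ∈ s, 0 < w a) {q : ℝ} (h0 : 0 < q) (h1 : q < 1) :
    HasSum (fun n => ((weightedMultisets w s n).ncard : ℝ) * q ^ n) (∏ a ∈ s, (1 - q ^ w a)⁻¹) := by
  classical
  induction s using Finset.induction_on with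
  | empty =>
    convert hasSum_single (f := fun n => ((weightedMultisets w ∅ n).ncard : ℝ) * q ^ n) 0 ?_ using 1
    · simp [weightedMultisets_empty]
    · intro n hn
      simp [weightedMultisets_empty, hn]
  | insert a s ha ih =>
    rw [Finset.prod_insert ha, mul_comm]
    have hwa := hw a (Finset.mem_insert_self a s)
    refine hasSum_of_shift_recursion (ih fun b hb => hw b (Finset.mem_insert_of_mem hb))
      (fun n => by positivity) (fun n => by positivity) (by positivity)
      (pow_lt_one₀ h0.le h1 hwa.ne') (w a) fun n => ?_
    rw [ncard_weightedMultisets_insert ha hw]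
    split_ifs with h
    · obtain ⟨m, rfl⟩ := Nat.exists_eq_add_of_le h
      rw [Nat.add_sub_cancel_left]
      push_cast
      ring
    · simp

/-! ### Comparison of coefficients -/

theorem eq_zero_of_hasSum_pow {d : ℕ → ℝ}
    (h : ∀ q : ℝ, 0 < q → q < 1 → HasSum (fun n => d n * q ^ n) 0) (n : ℕ) : d n = 0 := by
  have key : ∀ e : ℕ → ℝ, (∀ q : ℝ, 0 < q → q < 1 → HasSum (fun n => e n * q ^ n) 0) → e 0 = 0 := by
    intro e he
    -- As `q` tends to 0 from the right only the constant term survives; the series at `q = 1 / 2`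
    -- dominates.
    have hlim : Tendsto (fun q : ℝ => ∑' n, e n * q ^ n) (𝓝[>] 0) (𝓝 (∑' n, e n * 0 ^ n)) := by
      refine tendsto_tsum_of_dominated_convergence
        (he (1 / 2) (by norm_num) (by norm_num)).summable.norm (fun n => ?_) ?_
      · exact ((continuous_const.mul (continuous_pow n)).tendsto 0).mono_left nhdsWithin_le_nhds
      · filter_upwards [Ioo_mem_nhdsGT (show (0 : ℝ) < 1 / 2 by norm_num)] with q hq n
        rw [norm_mul, norm_mul]
        refine mul_le_mul_of_nonneg_left ?_ (norm_nonneg _)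
        rw [Real.norm_of_nonneg (pow_nonneg hq.1.le n), Real.norm_of_nonneg (by positivity)]
        exact pow_le_pow_left₀ hq.1.le hq.2.le n
    have hzero : Tendsto (fun q : ℝ => ∑' n, e n * q ^ n) (𝓝[>] 0) (𝓝 0) := by
      refine tendsto_const_nhds.congr' ?_
      filter_upwards [Ioo_mem_nhdsGT (show (0 : ℝ) < 1 by norm_num)] with q hq
      exact (he q hq.1 hq.2).tsum_eq.symm
    have h1 := tendsto_nhds_unique hlim hzero
    rwa [tsum_eq_single 0 (fun n hn => by simp [hn]), pow_zero, mul_one] at h1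
  induction n using Nat.strong_induction_on with
  | _ n ih =>
    -- Once the lower coefficients vanish, dividing by `q ^ n` makes `d n` the constant term.
    have h2 := key (fun k => d (k + n)) fun q h0 h1 => by
      have h3 := (hasSum_nat_add_iff' n).2 (h q h0 h1)
      rw [Finset.sum_eq_zero fun i hi => by rw [ih i (Finset.mem_range.1 hi), zero_mul],
        sub_zero] at h3
      have h4 := h3.mul_left (q ^ n)⁻¹
      rw [mul_zero] at h4
      refine h4.congr_fun fun k => ?_
      have : q ^ n ≠ 0 := (pow_pos h0 n).ne'
      rw [pow_add]; field_simp
    simpa using h2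

/-! ### Generating functions of the colored partitions -/

theorem congrPM_sixty_iff {S : Finset ℕ} (hS : S ⊆ Finset.Icc 1 29) (k : ℕ) :
    CongrPM 60 S k ↔ k % 60 ∈ S ∪ S.image (60 - ·) := by
  simp only [CongrPM, Int.ModEq, Finset.mem_union, Finset.mem_image]
  constructor
  · rintro ⟨r, hr, h⟩
    have := Finset.mem_Icc.1 (hS hr)
    rcases h with h | h
    · refine Or.inl ?_
      rwa [show k % 60 = r by push_cast at h; omega]
    · refine Or.inr ⟨r, hr, ?_⟩
      push_cast at h; omega
  · rintro (h | ⟨r, hr, h⟩)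
    · have := Finset.mem_Icc.1 (hS h)
      exact ⟨_, h, Or.inl (by push_cast; omega)⟩
    · have := Finset.mem_Icc.1 (hS hr)
      exact ⟨r, hr, Or.inr (by push_cast; omega)⟩

-- The range is cut into blocks of 60. As `S` lies in `[1, 29]`, the residues `r` and `60 - r` are
-- all distinct, so each occurs once per block.
open Classical in
theorem prod_congrPM_sixty {S : Finset ℕ} (hS : S ⊆ Finset.Icc 1 29) (q : ℝ) (N : ℕ) :
    (∏ k ∈ Finset.range (60 * N), if CongrPM 60 S k then 1 - q ^ k else 1) =
      ∏ r ∈ S, (∏ j ∈ Finset.range N, (1 + -q ^ r * (q ^ 60) ^ j)) *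
        ∏ j ∈ Finset.range N, (1 + -q ^ (60 - r) * (q ^ 60) ^ j) := by
  have hblock : ∀ j : ℕ,
      (∏ r ∈ Finset.range 60, if CongrPM 60 S (60 * j + r) then 1 - q ^ (60 * j + r) else 1) =
        ∏ r ∈ S, (1 + -q ^ r * (q ^ 60) ^ j) * (1 + -q ^ (60 - r) * (q ^ 60) ^ j) := by
    intro j
    have hpow : ∀ r, 1 - q ^ (60 * j + r) = 1 + -q ^ r * (q ^ 60) ^ j := fun r => by
      rw [pow_add, pow_mul]; ring
    have hdisj : Disjoint S (S.image (60 - ·)) := by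
      rw [Finset.disjoint_left]
      intro r hr h
      obtain ⟨s, hs, e⟩ := Finset.mem_image.1 h
      have := Finset.mem_Icc.1 (hS hr)
      have := Finset.mem_Icc.1 (hS hs)
      omega
    have hfilter : (Finset.range 60).filter (fun r => CongrPM 60 S (60 * j + r)) =
        S ∪ S.image (60 - ·) := by
      ext r
      rw [Finset.mem_filter, congrPM_sixty_iff hS, Nat.mul_add_mod, Finset.mem_range]
      constructor
      · rintro ⟨h, h'⟩
        rwa [Nat.mod_eq_of_lt h] at h'
      · intro h
        have hr : r < 60 := by
          rcases Finset.mem_union.1 h with h | h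
          · have := Finset.mem_Icc.1 (hS h); omega
          · obtain ⟨s, hs, rfl⟩ := Finset.mem_image.1 h
            have := Finset.mem_Icc.1 (hS hs); omega
        exact ⟨hr, by rwa [Nat.mod_eq_of_lt hr]⟩
    rw [← Finset.prod_filter, hfilter, Finset.prod_union hdisj, Finset.prod_image,
      ← Finset.prod_mul_distrib]
    · simp only [hpow]
    · intro a ha b hb h
      have := Finset.mem_Icc.1 (hS ha)
      have := Finset.mem_Icc.1 (hS hb)
      dsimp only at h
      omega
  have hsplit : ∀ F : ℕ → ℝ, ∏ k ∈ Finset.range (60 * N), F k =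
      ∏ j ∈ Finset.range N, ∏ r ∈ Finset.range 60, F (60 * j + r) := by
    intro F
    induction N with
    | zero => simp
    | succ N ih => rw [Nat.mul_succ, Finset.prod_range_add, ih, Finset.prod_range_succ _ N]
  rw [hsplit]
  simp only [hblock]
  rw [Finset.prod_comm]
  simp only [Finset.prod_mul_distrib]

open Classical in
theorem tendsto_prod_congrPM_sixty {S : Finset ℕ} (hS : S ⊆ Finset.Icc 1 29) {q : ℝ}
    (h0 : 0 < q) (h1 : q < 1) :
    Tendsto (fun N => ∏ k ∈ Finset.range (60 * N), if CongrPM 60 S k then 1 - q ^ k else 1) atTop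
      (𝓝 (theta60Prod q S)) := by
  have p0 : 0 < q ^ 60 := pow_pos h0 60
  have p1 : q ^ 60 < 1 := pow_lt_one₀ h0.le h1 (by norm_num)
  simp only [prod_congrPM_sixty hS]
  refine tendsto_finsetProd _ fun r hr => ?_
  have hr' := Finset.mem_Icc.1 (hS hr)
  have e : q ^ 60 / -q ^ r = -q ^ (60 - r) := by
    rw [div_neg, pow_sub₀ q h0.ne' (by omega), div_eq_mul_inv]
  have h := (tendsto_qProd p0 p1 (-q ^ r)).mul (tendsto_qProd p0 p1 (-q ^ (60 - r)))
  rw [← e] at h ⊢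
  exact h

open Classical in
/-- The colored parts of size less than `N` that are allowed in `coloredPartitions M S D`. -/
noncomputable def coloredParts (M : ℕ) (S D : Finset ℕ) (N : ℕ) : Finset (ℕ × Fin 2) :=
  (Finset.range N ×ˢ Finset.univ).filter
    fun x => 0 < x.1 ∧ CongrPM M S x.1 ∧ (x.2 = 1 → CongrPM M D x.1)

theorem mem_coloredParts {M : ℕ} {S D : Finset ℕ} {N : ℕ} {x : ℕ × Fin 2} :
    x ∈ coloredParts M S D N ↔
      x.1 < N ∧ 0 < x.1 ∧ CongrPM M S x.1 ∧ (x.2 = 1 → CongrPM M D x.1) := by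
  simp [coloredParts]

theorem weightedMultisets_coloredParts_subset (M : ℕ) (S D : Finset ℕ) (N n : ℕ) :
    weightedMultisets Prod.fst (coloredParts M S D N) n ⊆ coloredPartitions M S D n :=
  fun _ hP => ⟨fun x hx => (mem_coloredParts.1 (hP.1 x hx)).2, hP.2⟩

theorem weightedMultisets_coloredParts (M : ℕ) (S D : Finset ℕ) {N n : ℕ} (hn : n < N) :
    weightedMultisets Prod.fst (coloredParts M S D N) n = coloredPartitions M S D n := by
  refine (weightedMultisets_coloredParts_subset M S D N n).antisymm fun P hP => ⟨fun x hx => ?_, hP.2⟩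
  have hle : x.1 ≤ n := hP.2 ▸
    Multiset.single_le_sum (fun _ _ => Nat.zero_le _) _ (Multiset.mem_map_of_mem _ hx)
  exact mem_coloredParts.2 ⟨by omega, hP.1 x hx⟩

/-- Color 0 contributes the product over `S` and color 1 the product over `D`. -/
theorem tendsto_prod_coloredParts {S D : Finset ℕ} (hS : S ⊆ Finset.Icc 1 29) (hD : D ⊆ S) {q : ℝ}
    (h0 : 0 < q) (h1 : q < 1) :
    Tendsto (fun N => ∏ x ∈ coloredParts 60 S D (60 * N), (1 - q ^ x.1)) atTop
      (𝓝 (theta60Prod q S * theta60Prod q D)) := by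
  classical
  refine ((tendsto_prod_congrPM_sixty hS h0 h1).mul
    (tendsto_prod_congrPM_sixty (hD.trans hS) h0 h1)).congr fun N => ?_
  rw [coloredParts, Finset.prod_filter, Finset.prod_product, ← Finset.prod_mul_distrib]
  refine Finset.prod_congr rfl fun k _ => ?_
  have hDS : CongrPM 60 D k → CongrPM 60 S k := fun ⟨r, hr, h⟩ => ⟨r, hD hr, h⟩
  have hpos : CongrPM 60 S k → 0 < k := fun h => by
    rw [congrPM_sixty_iff hS] at h
    by_contra hk
    obtain rfl : k = 0 := by omega
    rcases Finset.mem_union.1 h with h | h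
    · simpa using hS h
    · obtain ⟨s, hs, e⟩ := Finset.mem_image.1 h
      have := Finset.mem_Icc.1 (hS hs); omega
  rw [Fin.prod_univ_two]
  by_cases hs : CongrPM 60 S k
  · simp [hs, hpos hs]
  · simp [hs, mt hDS hs]

theorem theta60Prod_pos {S : Finset ℕ} (hS : S ⊆ Finset.Icc 1 29) {q : ℝ}
    (h0 : 0 < q) (h1 : q < 1) : 0 < theta60Prod q S :=
  Finset.prod_pos fun r hr => by
    have := Finset.mem_Icc.1 (hS hr)
    exact theta60_pos h0 h1 (by omega) (by omega)

/-- Parts are truncated below `60 * N`. The counts agree for `n < 60 * N`, so partial sums are at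
most the limit of the finite products; truncated counts never exceed full ones, which gives the
reverse inequality. -/
theorem hasSum_numColoredPartitions {S D : Finset ℕ} (hS : S ⊆ Finset.Icc 1 29) (hD : D ⊆ S)
    {q : ℝ} (h0 : 0 < q) (h1 : q < 1) :
    HasSum (fun n => (numColoredPartitions 60 S D n : ℝ) * q ^ n)
      (1 / (theta60Prod q S * theta60Prod q D)) := by
  have hX := mul_pos (theta60Prod_pos hS h0 h1) (theta60Prod_pos (hD.trans hS) h0 h1)
  have hlim := (tendsto_prod_coloredParts hS hD h0 h1).inv₀ hX.ne'
  simp only [← Finset.prod_inv_distrib] at hlim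
  rw [← one_div] at hlim
  have hsum : ∀ N, HasSum (fun n =>
      ((weightedMultisets Prod.fst (coloredParts 60 S D (60 * N)) n).ncard : ℝ) * q ^ n)
      (∏ x ∈ coloredParts 60 S D (60 * N), (1 - q ^ x.1)⁻¹) := fun N =>
    hasSum_ncard_weightedMultisets (fun x hx => (mem_coloredParts.1 hx).2.1) h0 h1
  have hle : ∀ m, ∑ n ∈ Finset.range m, (numColoredPartitions 60 S D n : ℝ) * q ^ n ≤
      1 / (theta60Prod q S * theta60Prod q D) := fun m => by
    refine ge_of_tendsto hlim ((eventually_ge_atTop m).mono fun N hN => ?_)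
    refine le_trans (le_of_eq ?_) (sum_le_hasSum (Finset.range m) (fun _ _ => by positivity) (hsum N))
    refine Finset.sum_congr rfl fun n hn => ?_
    have := Finset.mem_range.1 hn
    rw [weightedMultisets_coloredParts 60 S D (by omega), numColoredPartitions]
  have hs : Summable fun n => (numColoredPartitions 60 S D n : ℝ) * q ^ n :=
    summable_of_sum_range_le (fun n => by positivity) hle
  have hge : 1 / (theta60Prod q S * theta60Prod q D) ≤
      ∑' n, (numColoredPartitions 60 S D n : ℝ) * q ^ n := by
    refine le_of_tendsto' hlim fun N => hasSum_le (fun n => ?_) (hsum N) hs.hasSum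
    refine mul_le_mul_of_nonneg_right (Nat.cast_le.2 ?_) (by positivity)
    exact Set.ncard_le_ncard (weightedMultisets_coloredParts_subset 60 S D _ n)
      (coloredPartitions_finite 60 S D n)
  exact (le_antisymm (Real.tsum_le_of_sum_range_le (fun n => by positivity) hle) hge) ▸ hs.hasSum

theorem hasSum_shift_mul_pow {a : ℕ → ℝ} {q A : ℝ} (h : HasSum (fun n => a n * q ^ n) A) (w : ℕ) :
    HasSum (fun n => (if w ≤ n then a (n - w) else 0) * q ^ n) (q ^ w * A) := by
  refine ((hasSum_shift h w).mul_left (q ^ w)).congr_fun fun n => ?_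
  split_ifs with hn
  · obtain ⟨m, rfl⟩ := Nat.exists_eq_add_of_le hn
    rw [Nat.add_sub_cancel_left, pow_add]; ring
  · simp

/-! ### The partition identity -/

theorem theorem7p3 (n : ℕ) (hn : 1 < n) :
    p7 n + p8 (n - 1) = p9 n + p10 (n - 2) := by
  -- Multiplication by `q` and `q ^ 2` shifts coefficients and leaves zeros in front. The guards
  -- supply these zeros where natural subtraction would truncate.
  have h := eq_zero_of_hasSum_pow (d := fun n => (p7 n : ℝ) + (if 1 ≤ n then (p8 (n - 1) : ℝ) else 0)
    - (p9 n + if 2 ≤ n then (p10 (n - 2) : ℝ) else 0)) (fun q h0 h1 => ?_) n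
  · simp only [show 1 ≤ n from hn.le, show 2 ≤ n from hn, if_true] at h
    exact_mod_cast sub_eq_zero.1 h
  · have h7 := hasSum_numColoredPartitions
      (S := {2, 6, 7, 8, 9, 10, 12, 13, 17, 21, 22, 23, 24, 28}) (D := {10})
      (by decide) (by decide) h0 h1
    have h8 := hasSum_numColoredPartitions
      (S := {1, 3, 4, 10, 11, 12, 14, 16, 18, 19, 24, 26, 27, 29}) (D := {10})
      (by decide) (by decide) h0 h1
    have h9 := hasSum_numColoredPartitions
      (S := {1, 4, 5, 6, 11, 12, 14, 16, 18, 19, 25, 26, 29}) (D := {12, 18})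
      (by decide) (by decide) h0 h1
    have h10 := hasSum_numColoredPartitions
      (S := {2, 5, 6, 7, 8, 13, 17, 18, 22, 23, 24, 25, 28}) (D := {6, 24})
      (by decide) (by decide) h0 h1
    have hsum := (h7.add (hasSum_shift_mul_pow h8 1)).sub (h9.add (hasSum_shift_mul_pow h10 2))
    rw [pow_one, mul_one_div, mul_one_div, theta60Prod_identity h0 h1, sub_self] at hsum
    refine hsum.congr_fun fun n => ?_
    simp only [p7, p8, p9, p10]
    ring
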